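/- Let $G=(X,Y;E)$ be a finite simple connected bipartite graph with partition classes $X$ and $Y$ that is balanced, i.e. $|X|=|Y|=n$ (so $G$ has order $2n$), where $n\ge 4$, and suppose that its minimum degree satisfies $\delta\ge 2$. Let $q_1$ be the largest eigenvalue of the signless Laplacian matrix $Q(G)=D(G)+A(G)$, where $D(G)$ is the diagonal matrix of vertex degrees and $A(G)$ is the adjacency matrix of $G$. If $$q_1\ \ge\ \frac{2(n^2-n+2)}{n},$$ then $G$ is bipancyclic, i.e. $G$ contains a cycle of every even length from $4$ to $2n$. -/

import Mathlib

namespace SimpleGraph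

/-- `X` and `Y` are the two partition classes of the bipartite graph `G`: they are disjoint,
they cover all vertices, every edge joins `X` to `Y`; and `G` is balanced, i.e. `|X| = |Y|`. -/
structure IsBalancedBipartiteWith {V : Type*} [Fintype V] [DecidableEq V]
    (G : SimpleGraph V) (X Y : Finset V) : Prop where
  isBipartiteWith : G.IsBipartiteWith (X : Set V) (Y : Set V)
  union_eq : X ∪ Y = Finset.univ
  card_eq : X.card = Y.card

/-- `G` contains cycles of every even length from `4` to `|V(G)|`. -/
def IsBipancyclic {V : Type*} [Fintype V] (G : SimpleGraph V) : Prop :=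
  ∀ l : ℕ, Even l → 4 ≤ l → l ≤ Fintype.card V →
    ∃ (v : V) (p : G.Walk v v), p.IsCycle ∧ p.length = l

/-- The signless Laplacian matrix `Q(G) = D(G) + A(G)`. -/
def signlessLapMatrix {V : Type*} [Fintype V] [DecidableEq V]
    (G : SimpleGraph V) [DecidableRel G.Adj] : Matrix V V ℝ :=
  G.degMatrix ℝ + G.adjMatrix ℝ

/-- `q` is the largest signless Laplacian eigenvalue `q₁(G)`.  The matrix is real symmetric, so
all its eigenvalues are real. -/
def IsLargestSignlessLapEigenvalue {V : Type*} [Fintype V] [DecidableEq V]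
    (G : SimpleGraph V) [DecidableRel G.Adj] (q : ℝ) : Prop :=
  IsGreatest {μ : ℝ | Module.End.HasEigenvalue (Matrix.toLin' G.signlessLapMatrix) μ} q

end SimpleGraph

/-! Let `e` be the number of edges. Every row sum of `D⁻¹QD` is at most `n + e/n`, so the spectral
hypothesis forces `e ≥ n² - 2n + 4`; in case of equality all row sums equal `q₁`, which excludes
vertices of degree 2 (`degree_sq_add_sum_eq_of_hasEigenvalue`). A non-Hamiltonian `G` has `e ≤ n² -
km` for some `k + m = n` with `k, m ≥ δ` (`card_edgeFinset_le_of_not_hamiltonian`). Taking `δ = 2`,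
or `δ = 3` in the equality case, contradicts this count, so `G` is Hamiltonian. As `2e > n(n + 1)`,
some edge of the Hamiltonian cycle has degree sum at least `n + 2`, and its chords close up cycles
of all even lengths (`IsCycleSeq.isBipancyclic`). -/

namespace SimpleGraph

variable {V : Type*}

/-! ### Paths and cycles as sequences, and their surgery. -/

/-- The values `c 0, …, c (L - 1)` form a path in `G`, with the vertices in this order. -/
structure IsPathSeq (G : SimpleGraph V) (L : ℕ) (c : ℕ → V) : Prop where
  inj : ∀ i < L, ∀ j < L, c i = c j → i = j
  adj : ∀ i, i + 1 < L → G.Adj (c i) (c (i + 1))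

/-- The values `c 0, …, c (L - 1)` form a cycle in `G`, with the vertices in this order. -/
structure IsCycleSeq (G : SimpleGraph V) (L : ℕ) (c : ℕ → V) : Prop extends
    G.IsPathSeq L c where
  adj_last : G.Adj (c (L - 1)) (c 0)

theorem IsCycleSeq.exists_isCycle {G : SimpleGraph V} {L : ℕ} {c : ℕ → V}
    (h : G.IsCycleSeq L c) (hL : 3 ≤ L) :
    ∃ (v : V) (p : G.Walk v v), p.IsCycle ∧ p.length = L := by
  rw [← cycleGraph_isContained_iff (by omega)]
  obtain ⟨L, rfl⟩ : ∃ k, L = k + 2 := ⟨L - 2, by omega⟩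
  have key : ∀ a b : Fin (L + 2), a - b = 1 → G.Adj (c b) (c a) := by
    intro a b hab
    obtain rfl : a = 1 + b := by rw [← hab]; simp
    by_cases hb : b.val + 1 < L + 2
    · have : (1 + b).val = b.val + 1 := by
        rw [Fin.val_add, Fin.val_one, add_comm, Nat.mod_eq_of_lt hb]
      rw [this]
      exact h.adj _ hb
    · have hb' : b.val = L + 1 := by omega
      have : (1 + b).val = 0 := by
        rw [Fin.val_add, Fin.val_one, hb']
        have : 1 + (L + 1) = L + 2 := by omega
        rw [this, Nat.mod_self]
      rw [this, hb']
      exact h.adj_last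
  refine ⟨⟨⟨fun i => c i, ?_⟩, ?_⟩⟩
  · intro a b hab
    rw [cycleGraph_adj] at hab
    rcases hab with hab | hab
    · exact (key _ _ hab).symm
    · exact key _ _ hab
  · intro a b hab
    exact Fin.ext (h.inj _ a.2 _ b.2 hab)

/-- A cycle can be cut open at each of its edges. -/
theorem IsCycleSeq.exists_rotate {G : SimpleGraph V} {L : ℕ} {c : ℕ → V}
    (h : G.IsCycleSeq L c) {i : ℕ} (hi : i < L) :
    ∃ c' : ℕ → V, G.IsCycleSeq L c' ∧ c' (L - 1) = c i ∧
      c' 0 = c (if i + 1 < L then i + 1 else 0) := by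
  refine ⟨fun j => c (if i + 1 + j < L then i + 1 + j else i + 1 + j - L), ⟨⟨?_, ?_⟩, ?_⟩, ?_, ?_⟩
  · intro a ha b hb hab
    have := h.inj _ (by split_ifs <;> omega) _ (by split_ifs <;> omega) hab
    split_ifs at this <;> omega
  · intro a ha
    by_cases h1 : i + 1 + a + 1 < L
    · rw [if_pos (by omega), if_pos (by omega)]
      exact h.adj _ (by omega)
    · by_cases h2 : i + 1 + a < L
      · rw [if_pos h2, if_neg (by omega)]
        have e1 : i + 1 + a = L - 1 := by omega
        have e2 : i + 1 + (a + 1) - L = 0 := by omega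
        rw [e1, e2]
        exact h.adj_last
      · rw [if_neg h2, if_neg (by omega)]
        have e2 : i + 1 + (a + 1) - L = i + 1 + a - L + 1 := by omega
        rw [e2]
        exact h.adj _ (by omega)
  · rw [if_neg (by omega)]
    have e1 : i + 1 + (L - 1) - L = i := by omega
    rw [e1]
    by_cases h1 : i + 1 < L
    · rw [if_pos (by omega)]
      exact h.adj _ h1
    · rw [if_neg (by omega)]
      have e1 : i = L - 1 := by omega
      have e2 : i + 1 + 0 - L = 0 := by omega
      rw [e2, e1]
      exact h.adj_last
  · dsimp only
    rw [if_neg (by omega)]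
    congr 1
    omega
  · dsimp only
    congr 1
    split_ifs <;> omega

/-- The cycle `c 0, …, c a, c (L - 1), c (L - 2), …, c b`. -/
theorem IsPathSeq.isCycleSeq_of_crossing {G : SimpleGraph V} {L a b : ℕ} {c : ℕ → V}
    (h : G.IsPathSeq L c) (hab : a < b) (hb : b < L)
    (h0 : G.Adj (c 0) (c b)) (h1 : G.Adj (c (L - 1)) (c a)) :
    G.IsCycleSeq (a + 1 + L - b) (fun i => c (if i ≤ a then i else L - 1 - (i - (a + 1)))) := by
  refine ⟨⟨?_, ?_⟩, ?_⟩
  · intro i hi j hj hij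
    have := h.inj _ (by split_ifs <;> omega) _ (by split_ifs <;> omega) hij
    split_ifs at this <;> omega
  · intro i hi
    by_cases h2 : i + 1 ≤ a
    · rw [if_pos (by omega), if_pos h2]
      exact h.adj _ (by omega)
    · by_cases h3 : i ≤ a
      · obtain rfl : i = a := by omega
        rw [if_pos h3, if_neg h2, Nat.sub_self, Nat.sub_zero]
        exact h1.symm
      · rw [if_neg h3, if_neg h2]
        have e : L - 1 - (i - (a + 1)) = L - 1 - (i + 1 - (a + 1)) + 1 := by omega
        rw [e]
        exact (h.adj _ (by omega)).symm
  · rw [if_neg (by omega), if_pos (by omega)]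
    have e : L - 1 - (a + 1 + L - b - 1 - (a + 1)) = b := by omega
    rw [e]
    exact h0.symm

/-- The cycle `c b, …, c a, c (L - 1), c 0`. -/
theorem IsCycleSeq.isCycleSeq_of_chords {G : SimpleGraph V} {L a b : ℕ} {c : ℕ → V}
    (h : G.IsCycleSeq L c) (hab : b < a) (hb : 0 < b) (ha : a < L - 1)
    (h0 : G.Adj (c 0) (c b)) (h1 : G.Adj (c (L - 1)) (c a)) :
    G.IsCycleSeq (a - b + 3)
      (fun i => c (if i ≤ a - b then b + i else if i = a - b + 1 then L - 1 else 0)) := by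
  refine ⟨⟨?_, ?_⟩, ?_⟩
  · intro i hi j hj hij
    have := h.inj _ (by split_ifs <;> omega) _ (by split_ifs <;> omega) hij
    split_ifs at this <;> omega
  · intro i hi
    by_cases h2 : i + 1 ≤ a - b
    · rw [if_pos (by omega), if_pos h2]
      exact h.adj _ (by omega)
    · by_cases h3 : i ≤ a - b
      · have e : b + i = a := by omega
        rw [if_pos h3, if_neg h2, if_pos (by omega), e]
        exact h1.symm
      · rw [if_neg h3, if_neg h2, if_pos (by omega), if_neg (by omega)]
        exact h.adj_last
  · rw [if_neg (by omega), if_neg (by omega), if_pos (by omega), add_zero]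
    exact h0

/-! ### Ends of Hamiltonian paths in bipartite graphs. -/

/-- Along a path in a bipartite graph the two classes alternate. -/
theorem IsPathSeq.mem_iff {G : SimpleGraph V} {X : Set V} {L : ℕ} {c : ℕ → V}
    (h : G.IsPathSeq L c) (hX : ∀ u w, G.Adj u w → (u ∈ X ↔ w ∉ X)) :
    ∀ i < L, (c i ∈ X ↔ (i % 2 = 0 ↔ c 0 ∈ X))
  | 0, _ => by simp
  | i + 1, hi => by
    have h1 := h.mem_iff hX i (by omega)
    have h2 := hX _ _ (h.adj i hi)
    have h3 : (i + 1) % 2 = 0 ↔ ¬ i % 2 = 0 := by omega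
    tauto

theorem IsPathSeq.parity_of_adj {G : SimpleGraph V} {X : Set V} {L : ℕ} {c : ℕ → V}
    (h : G.IsPathSeq L c) (hX : ∀ u w, G.Adj u w → (u ∈ X ↔ w ∉ X)) {i j : ℕ} (hi : i < L)
    (hj : j < L) (hij : G.Adj (c i) (c j)) : i % 2 ≠ j % 2 := by
  have h1 := h.mem_iff hX i hi
  have h2 := h.mem_iff hX j hj
  have h3 := hX _ _ hij
  intro h4
  rw [h4] at h1
  tauto

theorem IsPathSeq.surj [Fintype V] {G : SimpleGraph V} {c : ℕ → V}
    (h : G.IsPathSeq (Fintype.card V) c) (v : V) : ∃ i < Fintype.card V, c i = v := by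
  have hinj : Function.Injective (fun i : Fin (Fintype.card V) => c i) :=
    fun a b hab => Fin.ext (h.inj _ a.2 _ b.2 hab)
  have := ((Fintype.bijective_iff_injective_and_card _).2 ⟨hinj, by simp⟩).2 v
  obtain ⟨i, hi⟩ := this
  exact ⟨i, i.2, hi⟩

/-- The neighbors of an end `c 0` of a Hamiltonian path are among the `c (2 * t + 1)`. -/
theorem IsPathSeq.degree_first_le [Fintype V] {G : SimpleGraph V} [DecidableRel G.Adj]
    {X : Set V} {n : ℕ} {c : ℕ → V} (h : G.IsPathSeq (2 * n) c) (hn : 0 < n)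
    (hcard : Fintype.card V = 2 * n)
    (hX : ∀ u w, G.Adj u w → (u ∈ X ↔ w ∉ X)) :
    G.degree (c 0) ≤ ((Finset.range n).filter fun t => G.Adj (c 0) (c (2 * t + 1))).card := by
  classical
  rw [← card_neighborFinset_eq_degree]
  refine (Finset.card_le_card (t := Finset.image (fun t => c (2 * t + 1)) _) ?_).trans
    Finset.card_image_le
  intro v hv
  rw [mem_neighborFinset] at hv
  obtain ⟨i, hi, rfl⟩ := (hcard ▸ h).surj v
  rw [hcard] at hi
  have := h.parity_of_adj hX (by omega) hi hv
  have e : 2 * (i / 2) + 1 = i := by omega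
  simp only [Finset.mem_image, Finset.mem_filter, Finset.mem_range]
  exact ⟨i / 2, ⟨by omega, by rwa [e]⟩, by rw [e]⟩

/-- The neighbors of the end `c (2 * n - 1)` of a Hamiltonian path are among the `c (2 * s)`. -/
theorem IsPathSeq.degree_last_le [Fintype V] {G : SimpleGraph V} [DecidableRel G.Adj]
    {X : Set V} {n : ℕ} {c : ℕ → V} (h : G.IsPathSeq (2 * n) c) (hn : 0 < n)
    (hcard : Fintype.card V = 2 * n)
    (hX : ∀ u w, G.Adj u w → (u ∈ X ↔ w ∉ X)) :
    G.degree (c (2 * n - 1)) ≤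
      ((Finset.range n).filter fun s => G.Adj (c (2 * n - 1)) (c (2 * s))).card := by
  classical
  rw [← card_neighborFinset_eq_degree]
  refine (Finset.card_le_card (t := Finset.image (fun t => c (2 * t)) _) ?_).trans
    Finset.card_image_le
  intro v hv
  rw [mem_neighborFinset] at hv
  obtain ⟨i, hi, rfl⟩ := (hcard ▸ h).surj v
  rw [hcard] at hi
  have := h.parity_of_adj hX (by omega) hi hv
  have e : 2 * (i / 2) = i := by omega
  simp only [Finset.mem_image, Finset.mem_filter, Finset.mem_range]
  exact ⟨i / 2, ⟨by omega, by rwa [e]⟩, by rw [e]⟩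

/-- In a bipartite graph without Hamiltonian cycle, the degrees of the ends of a Hamiltonian path
sum to at most `n`. -/
theorem IsPathSeq.degree_add_degree_le [Fintype V] {G : SimpleGraph V} [DecidableRel G.Adj]
    {X : Set V} {n : ℕ} {c : ℕ → V} (h : G.IsPathSeq (2 * n) c) (hn : 0 < n)
    (hcard : Fintype.card V = 2 * n)
    (hX : ∀ u w, G.Adj u w → (u ∈ X ↔ w ∉ X)) (hham : ∀ c, ¬ G.IsCycleSeq (2 * n) c) :
    G.degree (c 0) + G.degree (c (2 * n - 1)) ≤ n := by
  refine (add_le_add (h.degree_first_le hn hcard hX) (h.degree_last_le hn hcard hX)).trans ?_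
  rw [← Finset.card_union_of_disjoint]
  · exact (Finset.card_le_card (Finset.union_subset (Finset.filter_subset _ _)
      (Finset.filter_subset _ _))).trans (by simp)
  · rw [Finset.disjoint_left]
    intro t ht1 ht2
    simp only [Finset.mem_filter, Finset.mem_range] at ht1 ht2
    have := h.isCycleSeq_of_crossing (by omega) (by omega) ht1.2 ht2.2
    have e : 2 * t + 1 + 2 * n - (2 * t + 1) = 2 * n := by omega
    rw [e] at this
    exact hham _ this

/-! ### From a Hamiltonian cycle to all even lengths. -/

/-- In a Hamiltonian bipartite graph, two adjacent vertices on a Hamiltonian cycle whose degrees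
sum to at least `n + 2` give cycles of all even lengths. -/
theorem IsCycleSeq.exists_isCycleSeq_of_degree [Fintype V] {G : SimpleGraph V}
    [DecidableRel G.Adj] {X : Set V} {n : ℕ} {c : ℕ → V} (h : G.IsCycleSeq (2 * n) c)
    (hcard : Fintype.card V = 2 * n)
    (hX : ∀ u w, G.Adj u w → (u ∈ X ↔ w ∉ X))
    (hdeg : n + 2 ≤ G.degree (c 0) + G.degree (c (2 * n - 1))) {l : ℕ} (hl : 2 ≤ l)
    (hln : l ≤ n) : ∃ c', G.IsCycleSeq (2 * l) c' := by
  classical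
  by_contra! hno
  set A := (Finset.range n).filter fun s => G.Adj (c (2 * n - 1)) (c (2 * s)) with hA
  set B := (Finset.range n).filter fun t => G.Adj (c 0) (c (2 * t + 1)) with hB
  have hdA : G.degree (c (2 * n - 1)) ≤ A.card := h.degree_last_le (by omega) hcard hX
  have hdB : G.degree (c 0) ≤ B.card := h.degree_first_le (by omega) hcard hX
  -- The erased indices stand for the closing edge of the cycle, which is not a chord.
  have hA1 : A.card - 1 ≤ (A.erase 0).card := Finset.pred_card_le_card_erase
  have hB1 : B.card - 1 ≤ (B.erase (n - 1)).card := Finset.pred_card_le_card_erase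
  -- Subtraction of `l - 1` modulo `n - 1`. If `φ s = t`, the chords to `c (2 * s)` and `c (2 * t +
  -- 1)` close a cycle of length `2 * l`, so the two index sets are disjoint; but together they have
  -- at least `n` elements among `n - 1` values.
  set φ : ℕ → ℕ := fun s => if l - 1 ≤ s then s - (l - 1) else s + n - l with hφ
  have hAφ : ((A.erase 0).image φ).card = (A.erase 0).card := by
    apply Finset.card_image_of_injOn
    intro s hs s' hs' hss
    simp only [hA, Finset.coe_erase, Finset.coe_filter, Finset.mem_range, Set.mem_sdiff,
      Set.mem_ofPred_eq, Set.mem_singleton_iff] at hs hs'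
    simp only [hφ] at hss
    split_ifs at hss <;> omega
  have hdisj : Disjoint ((A.erase 0).image φ) (B.erase (n - 1)) := by
    rw [Finset.disjoint_left]
    intro t ht1 ht2
    simp only [hA, hB, Finset.mem_erase, Finset.mem_image, Finset.mem_filter,
      Finset.mem_range] at ht1 ht2
    obtain ⟨s, ⟨hs0, hsn, hs⟩, hst⟩ := ht1
    obtain ⟨htn1, htn, ht⟩ := ht2
    simp only [hφ] at hst
    split_ifs at hst with hsl
    · have := h.isCycleSeq_of_chords (by omega) (by omega) (by omega) ht hs
      have e : 2 * s - (2 * t + 1) + 3 = 2 * l := by omega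
      exact hno _ (e ▸ this)
    · have := h.isCycleSeq_of_crossing (by omega) (by omega) ht hs
      have e : 2 * s + 1 + 2 * n - (2 * t + 1) = 2 * l := by omega
      exact hno _ (e ▸ this)
  have hsub : (A.erase 0).image φ ∪ B.erase (n - 1) ⊆ Finset.range (n - 1) := by
    intro t ht
    simp only [hA, hB, Finset.mem_union, Finset.mem_erase, Finset.mem_image, Finset.mem_filter,
      Finset.mem_range] at ht ⊢
    rcases ht with ⟨s, ⟨hs0, hsn, -⟩, hst⟩ | ht
    · simp only [hφ] at hst
      split_ifs at hst <;> omega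
    · omega
  have := Finset.card_le_card hsub
  rw [Finset.card_union_of_disjoint hdisj, hAφ, Finset.card_range] at this
  omega

/-- Every second edge of the cycle gives a perfect matching; its `n` degree sums total `2e`, so one
of them exceeds the average bound `n + 1`. -/
theorem IsCycleSeq.isBipancyclic [Fintype V] {G : SimpleGraph V}
    [DecidableRel G.Adj] {X : Set V} {n : ℕ} {c : ℕ → V} (h : G.IsCycleSeq (2 * n) c)
    (hcard : Fintype.card V = 2 * n) (hX : ∀ u w, G.Adj u w → (u ∈ X ↔ w ∉ X))
    (he : n * (n + 1) < 2 * G.edgeFinset.card) : G.IsBipancyclic := by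
  classical
  have hsum : ∑ i ∈ Finset.range n, (G.degree (c (2 * i)) + G.degree (c (2 * i + 1))) =
      2 * G.edgeFinset.card := by
    have h1 : ∀ m, ∑ i ∈ Finset.range m, (G.degree (c (2 * i)) + G.degree (c (2 * i + 1))) =
        ∑ i ∈ Finset.range (2 * m), G.degree (c i) := by
      intro m
      induction m with
      | zero => simp
      | succ m ih =>
        rw [Finset.sum_range_succ, ih, show 2 * (m + 1) = 2 * m + 1 + 1 by ring,
          Finset.sum_range_succ, Finset.sum_range_succ, add_assoc]
    rw [h1, ← sum_degrees_eq_twice_card_edges]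
    refine Finset.sum_bij (fun i _ => c i) (by simp) ?_ ?_ (by simp)
    · intro i hi j hj hij
      exact h.inj i (by simpa using hi) j (by simpa using hj) hij
    · intro v _
      obtain ⟨i, hi, hiv⟩ := (hcard ▸ h.toIsPathSeq).surj v
      exact ⟨i, by simpa [hcard] using hi, hiv⟩
  obtain ⟨i, hi, hdeg⟩ : ∃ i ∈ Finset.range n,
      n + 1 < G.degree (c (2 * i)) + G.degree (c (2 * i + 1)) := by
    by_contra! hcon
    have := Finset.sum_le_sum hcon
    rw [hsum] at this
    simp only [Finset.sum_const, Finset.card_range, smul_eq_mul] at this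
    omega
  rw [Finset.mem_range] at hi
  obtain ⟨c', hc', hlast, hfirst⟩ := h.exists_rotate (i := 2 * i) (by omega)
  rw [if_pos (by omega)] at hfirst
  intro L hL hL4 hLn
  obtain ⟨l, rfl⟩ := even_iff_exists_two_mul.1 hL
  obtain ⟨c'', hc''⟩ := hc'.exists_isCycleSeq_of_degree hcard hX
    (by rw [hlast, hfirst]; omega) (l := l) (by omega) (by omega)
  exact hc''.exists_isCycle (by omega)

/-! ### Edge bound for non-Hamiltonian graphs. -/

theorem exists_isCycleSeq_of_complete {G : SimpleGraph V} {X Y : Finset V} {n : ℕ} (hn : 0 < n)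
    (hXY : Disjoint X Y) (hX : X.card = n) (hY : Y.card = n)
    (h : ∀ x ∈ X, ∀ y ∈ Y, G.Adj x y) : ∃ c, G.IsCycleSeq (2 * n) c := by
  have enum : ∀ S : Finset V, S.card = n → ∃ f : ℕ → V, (∀ i < n, f i ∈ S) ∧
      ∀ i < n, ∀ j < n, f i = f j → i = j := by
    intro S hS
    let e := (S.equivFinOfCardEq hS).symm
    refine ⟨fun i => if hi : i < n then e ⟨i, hi⟩ else e ⟨0, hn⟩, ?_, ?_⟩
    · intro i hi
      simp [hi]
    · intro i hi j hj hij
      simpa [hi, hj] using hij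
  obtain ⟨f, hfX, hf⟩ := enum X hX
  obtain ⟨g, hgY, hg⟩ := enum Y hY
  have hne : ∀ i < n, ∀ j < n, f i ≠ g j := fun i hi j hj hij =>
    Finset.disjoint_left.1 hXY (hfX i hi) (hij ▸ hgY j hj)
  refine ⟨fun i => if i % 2 = 0 then f (i / 2) else g (i / 2), ⟨?_, ?_⟩, ?_⟩
  · intro i hi j hj hij
    split_ifs at hij with h1 h2 h2
    · have := hf _ (by omega) _ (by omega) hij
      omega
    · exact absurd hij (hne _ (by omega) _ (by omega))
    · exact absurd hij.symm (hne _ (by omega) _ (by omega))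
    · have := hg _ (by omega) _ (by omega) hij
      omega
  · intro i hi
    by_cases h1 : i % 2 = 0
    · rw [if_pos h1, if_neg (by omega)]
      exact h _ (hfX _ (by omega)) _ (hgY _ (by omega))
    · rw [if_neg h1, if_pos (by omega)]
      exact (h _ (hfX _ (by omega)) _ (hgY _ (by omega))).symm
  · rw [if_neg (by omega), if_pos (by omega)]
    exact (h _ (hfX _ (by omega)) _ (hgY _ (by omega))).symm

/-- If adding the edge `xy` creates the first Hamiltonian cycle, then `x` and `y` are the ends of a
Hamiltonian path. -/
theorem IsCycleSeq.exists_isPathSeq_of_sup_edge {G : SimpleGraph V} {x y : V} {L : ℕ} {c : ℕ → V}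
    (h : (G ⊔ edge x y).IsCycleSeq L c) (hL : 3 ≤ L) (hG : ∀ c, ¬ G.IsCycleSeq L c) :
    ∃ c', G.IsPathSeq L c' ∧
      (c' 0 = x ∧ c' (L - 1) = y ∨ c' 0 = y ∧ c' (L - 1) = x) := by
  -- The cycle must use the new edge; rotation makes it the closing one.
  obtain ⟨i, hi, hadj⟩ : ∃ i < L, ¬ G.Adj (c i) (c (if i + 1 < L then i + 1 else 0)) := by
    by_contra! hcon
    refine hG c ⟨⟨h.inj, fun i hi => ?_⟩, ?_⟩
    · have := hcon i (by omega)
      rwa [if_pos hi] at this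
    · have := hcon (L - 1) (by omega)
      rwa [if_neg (by omega)] at this
  obtain ⟨c', hc', hlast, hfirst⟩ := h.exists_rotate hi
  have hends := hc'.adj_last
  rw [← hlast, ← hfirst] at hadj
  rw [sup_adj, edge_adj] at hends
  have hends' := (hends.resolve_left hadj).1
  refine ⟨c', ⟨hc'.inj, fun j hj => ?_⟩, by tauto⟩
  have hj' := hc'.adj j hj
  rw [sup_adj, edge_adj] at hj'
  refine hj'.resolve_right fun hbad => ?_
  have e1 := hc'.inj j (by omega) 0 (by omega)
  have e2 := hc'.inj j (by omega) (L - 1) (by omega)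
  have e4 := hc'.inj (j + 1) (by omega) (L - 1) (by omega)
  obtain ⟨⟨h1, h2⟩ | ⟨h1, h2⟩, -⟩ := hbad <;> obtain ⟨h3, h4⟩ | ⟨h3, h4⟩ := hends'
  · have := e2 (h1.trans h3.symm)
    omega
  · have := e1 (h1.trans h4.symm)
    have := e4 (h2.trans h3.symm)
    omega
  · have := e1 (h1.trans h4.symm)
    have := e4 (h2.trans h3.symm)
    omega
  · have := e2 (h1.trans h3.symm)
    omega

theorem IsBipartiteWith.mem_iff_notMem {G : SimpleGraph V} {X Y : Set V}
    (h : G.IsBipartiteWith X Y) (u w : V) (huw : G.Adj u w) : u ∈ X ↔ w ∉ X := by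
  have hd := Set.disjoint_left.1 h.disjoint
  rcases h.mem_of_adj huw with ⟨h1, h2⟩ | ⟨h1, h2⟩
  · exact ⟨fun _ hw => hd hw h2, fun _ => h1⟩
  · exact ⟨fun hu => absurd h1 (hd hu), fun hw => absurd h2 hw⟩

/-- A maximal non-Hamiltonian balanced bipartite graph has few edges. -/
theorem card_edgeFinset_le_of_maximal [Fintype V] [DecidableEq V] {G : SimpleGraph V}
    [DecidableRel G.Adj] {X Y : Finset V} {n δ : ℕ} (hn : 2 ≤ n)
    (hcard : Fintype.card V = 2 * n) (hX : X.card = n) (hY : Y.card = n)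
    (hG : G.IsBipartiteWith (X : Set V) Y) (hδ : ∀ v, δ ≤ G.degree v)
    (hham : ∀ c, ¬ G.IsCycleSeq (2 * n) c)
    (hmax : ∀ x ∈ X, ∀ y ∈ Y, ¬ G.Adj x y → ∃ c, (G ⊔ edge x y).IsCycleSeq (2 * n) c) :
    ∃ k m, k + m = n ∧ δ ≤ k ∧ δ ≤ m ∧ G.edgeFinset.card + k * m ≤ n ^ 2 := by
  have hdisj : Disjoint X Y := Finset.disjoint_coe.1 hG.disjoint
  have hpar := hG.mem_iff_notMem
  have hdeg : ∀ x ∈ X, ∀ y ∈ Y, ¬ G.Adj x y → G.degree x + G.degree y ≤ n := by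
    intro x hx y hy hxy
    obtain ⟨c, hc⟩ := hmax x hx y hy hxy
    obtain ⟨c', hc', ⟨h1, h2⟩ | ⟨h1, h2⟩⟩ := hc.exists_isPathSeq_of_sup_edge (by omega) hham
    all_goals
      have := hc'.degree_add_degree_le (by omega) hcard hpar hham
      rw [h1, h2] at this
      omega
  set N := (X ×ˢ Y).filter fun p => ¬ G.Adj p.1 p.2 with hN
  have hNne : N.Nonempty := by
    by_contra hempty
    rw [Finset.not_nonempty_iff_eq_empty, hN, Finset.filter_eq_empty_iff] at hempty
    obtain ⟨c, hc⟩ := exists_isCycleSeq_of_complete (G := G) (by omega) hdisj hX hY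
      fun x hx y hy => by
        have := hempty (Finset.mk_mem_product hx hy)
        simpa using this
    exact hham c hc
  -- By this choice, each vertex of `X` not adjacent to `y` has degree at most that of `x`.
  obtain ⟨⟨x, y⟩, hxy, hbest⟩ := N.exists_max_image (fun p => G.degree p.1 + G.degree p.2) hNne
  simp only [hN, Finset.mem_filter, Finset.mem_product, Prod.forall] at hxy hbest
  obtain ⟨⟨hx, hy⟩, hxy⟩ := hxy
  have hsum := hdeg x hx y hy hxy
  refine ⟨G.degree x, n - G.degree x, by omega, hδ x, by have := hδ y; omega, ?_⟩
  set S := X.filter fun s => ¬ G.Adj s y with hS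
  have hScard : S.card + G.degree y = n := by
    have h1 : X.filter (fun s => G.Adj s y) = G.neighborFinset y := by
      ext s
      simp only [Finset.mem_filter, mem_neighborFinset]
      refine ⟨fun h => h.2.symm, fun h => ⟨?_, h.symm⟩⟩
      exact_mod_cast hG.mem_of_mem_adj' (by exact_mod_cast hy) h.symm
    have h2 := Finset.card_filter_add_card_filter_not (s := X) (fun s => G.Adj s y)
    rw [h1, card_neighborFinset_eq_degree, ← hS] at h2
    omega
  rw [← isBipartiteWith_sum_degrees_eq_card_edges hG,
    ← Finset.sum_filter_add_sum_filter_not X (fun s => ¬ G.Adj s y)]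
  have hs1 : ∑ s ∈ S, G.degree s ≤ S.card * G.degree x := by
    rw [← smul_eq_mul]
    refine Finset.sum_le_card_nsmul _ _ _ fun s hs => ?_
    rw [hS, Finset.mem_filter] at hs
    have := hbest s y ⟨⟨hs.1, hy⟩, hs.2⟩
    omega
  have hs2 : ∑ s ∈ X with ¬ ¬ G.Adj s y, G.degree s ≤ G.degree y * n := by
    have hc : (X.filter fun s => ¬ ¬ G.Adj s y).card = G.degree y := by
      have := Finset.card_filter_add_card_filter_not (s := X) (fun s => ¬ G.Adj s y)
      rw [← hS] at this
      omega
    rw [← hc, ← smul_eq_mul]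
    refine Finset.sum_le_card_nsmul _ _ _ fun s hs => ?_
    rw [← hY]
    exact isBipartiteWith_degree_le hG (Finset.mem_filter.1 hs).1
  obtain ⟨m, hm⟩ : ∃ m, G.degree x + m = n := ⟨n - G.degree x, by omega⟩
  rw [show n - G.degree x = m by omega]
  obtain ⟨r, hr⟩ : ∃ r, S.card = G.degree x + r := ⟨S.card - G.degree x, by omega⟩
  have e1 : G.degree y + r = m := by omega
  rw [hr] at hs1
  subst e1
  -- With `k = d(x)` and `d(y) ≤ m`: `e ≤ (n - d(y))k + d(y)n = nk + d(y)m ≤ nk + m² = n² - km`.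
  nlinarith [Nat.zero_le (r * (G.degree y + r)), Nat.zero_le (r * G.degree y)]

/-- A Moon–Moser type bound for non-Hamiltonian balanced bipartite graphs. -/
theorem card_edgeFinset_le_of_not_hamiltonian [Fintype V] [DecidableEq V] {G : SimpleGraph V}
    [DecidableRel G.Adj] {X Y : Finset V} {n δ : ℕ} (hn : 2 ≤ n)
    (hcard : Fintype.card V = 2 * n) (hX : X.card = n) (hY : Y.card = n)
    (hG : G.IsBipartiteWith (X : Set V) Y) (hδ : ∀ v, δ ≤ G.degree v)
    (hham : ∀ c, ¬ G.IsCycleSeq (2 * n) c) :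
    ∃ k m, k + m = n ∧ δ ≤ k ∧ δ ≤ m ∧ G.edgeFinset.card + k * m ≤ n ^ 2 := by
  classical
  let P : Set (SimpleGraph V) :=
    {H | H.IsBipartiteWith (X : Set V) Y ∧ ∀ c, ¬ H.IsCycleSeq (2 * n) c}
  obtain ⟨H, hGH, hH⟩ := (Set.toFinite P).exists_le_maximal (a := G) ⟨hG, hham⟩
  obtain ⟨k, m, hkm, hk, hm, he⟩ := card_edgeFinset_le_of_maximal (G := H) (δ := δ) hn hcard hX hY
    hH.prop.1 (fun v => (hδ v).trans (degree_le_of_le hGH)) hH.prop.2 <| by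
      intro x hx y hy hxy
      by_contra! hno
      have hxX : x ∈ (X : Set V) := hx
      have hyY : y ∈ (Y : Set V) := hy
      have hmem : H ⊔ edge x y ∈ P := by
        refine ⟨⟨hG.disjoint, fun u w huw => ?_⟩, hno⟩
        rw [sup_adj, edge_adj] at huw
        rcases huw with huw | ⟨⟨rfl, rfl⟩ | ⟨rfl, rfl⟩, -⟩
        · exact hH.prop.1.mem_of_adj huw
        · exact Or.inl ⟨hxX, hyY⟩
        · exact Or.inr ⟨hyY, hxX⟩
      have hle := hH.le_of_ge hmem le_sup_left
      refine hxy (hle (Or.inr ?_))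
      rw [edge_adj]
      refine ⟨Or.inl ⟨rfl, rfl⟩, ?_⟩
      rintro rfl
      exact Set.disjoint_left.1 hG.disjoint hxX hyY
  refine ⟨k, m, hkm, hk, hm, le_trans ?_ he⟩
  gcongr

/-! ### Spectral input. -/

/-- If no row sum of `D⁻¹QD` exceeds an eigenvalue `q` of `Q`, then all of them are equal to `q`. -/
theorem degree_sq_add_sum_eq_of_hasEigenvalue [Fintype V] [DecidableEq V] {G : SimpleGraph V}
    [DecidableRel G.Adj] {q : ℝ} (hconn : G.Connected) (hpos : ∀ v, 0 < G.degree v)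
    (hq : Module.End.HasEigenvalue (Matrix.toLin' G.signlessLapMatrix) q)
    (h : ∀ v, (G.degree v : ℝ) ^ 2 + ∑ w ∈ G.neighborFinset v, (G.degree w : ℝ) ≤
      q * G.degree v) (v : V) :
    (G.degree v : ℝ) ^ 2 + ∑ w ∈ G.neighborFinset v, (G.degree w : ℝ) = q * G.degree v := by
  have hpos' : ∀ v, (0 : ℝ) < G.degree v := fun v => by exact_mod_cast hpos v
  obtain ⟨f, hf⟩ := hq.exists_hasEigenvector
  have heq : ∀ v, ∑ w ∈ G.neighborFinset v, f w = (q - G.degree v) * f v := by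
    intro v
    have := congrFun hf.apply_eq_smul v
    rw [Matrix.toLin'_apply, signlessLapMatrix, Matrix.add_mulVec, Pi.add_apply,
      degMatrix_mulVec_apply, adjMatrix_mulVec_apply, Pi.smul_apply, smul_eq_mul] at this
    linarith
  have := hconn.nonempty
  -- Maximum principle: where `|f| / deg` attains its maximum, the row sum equals `q` and all
  -- neighbors attain it too; connectedness does the rest.
  obtain ⟨v₀, -, hv₀⟩ := Finset.exists_max_image Finset.univ (fun v => |f v| / G.degree v)
    Finset.univ_nonempty
  set M := |f v₀| / G.degree v₀ with hM
  have hle : ∀ v, |f v| ≤ G.degree v * M := by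
    intro v
    have := hv₀ v (Finset.mem_univ v)
    rw [div_le_iff₀ (hpos' v)] at this
    linarith
  have hMpos : 0 < M := by
    by_contra hM0
    refine hf.2 (funext fun v => ?_)
    have h1 := hle v
    have h2 := hpos' v
    have h3 := abs_nonneg (f v)
    have : |f v| = 0 := by nlinarith
    simpa using this
  have hstep : ∀ v, |f v| = G.degree v * M →
      (∀ w, G.Adj v w → |f w| = G.degree w * M) ∧
      (G.degree v : ℝ) ^ 2 + ∑ w ∈ G.neighborFinset v, (G.degree w : ℝ) = q * G.degree v := by
    intro v hv
    have h1 : (q - G.degree v) * (G.degree v * M) ≤ ∑ w ∈ G.neighborFinset v, |f w| := by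
      rw [← hv]
      refine le_trans ?_ (Finset.abs_sum_le_sum_abs _ _)
      rw [heq, abs_mul]
      exact mul_le_mul_of_nonneg_right (le_abs_self _) (abs_nonneg _)
    have h2 : ∑ w ∈ G.neighborFinset v, |f w| ≤ ∑ w ∈ G.neighborFinset v, G.degree w * M :=
      Finset.sum_le_sum fun w _ => hle w
    have h3 := h v
    have h4 : ∑ w ∈ G.neighborFinset v, G.degree w * M =
        (∑ w ∈ G.neighborFinset v, (G.degree w : ℝ)) * M := by rw [Finset.sum_mul]
    refine ⟨fun w hw => ?_, ?_⟩
    · have h5 : ∑ w ∈ G.neighborFinset v, |f w| = ∑ w ∈ G.neighborFinset v, G.degree w * M := by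
        refine le_antisymm h2 ?_
        nlinarith
      exact (Finset.sum_eq_sum_iff_of_le fun w _ => hle w).1 h5 w (by simpa using hw)
    · refine le_antisymm h3 ?_
      rw [h4] at h2
      have := h1.trans h2
      rw [← mul_assoc] at this
      have := le_of_mul_le_mul_right this hMpos
      nlinarith
  obtain ⟨p⟩ := hconn.preconnected v₀ v
  have hwalk : ∀ (u w : V) (p : G.Walk u w), |f u| = G.degree u * M → |f w| = G.degree w * M := by
    intro u w p
    induction p with
    | nil => exact id
    | cons huv _ ih => exact fun hu => ih ((hstep _ hu).1 _ huv)
  refine (hstep v (hwalk _ _ p ?_)).2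
  rw [hM]
  field_simp [(hpos' v₀).ne']

theorem IsBipartiteWith.sum_degree_neighborFinset_le [Fintype V] [DecidableEq V]
    {G : SimpleGraph V} [DecidableRel G.Adj] {X Y : Finset V}
    (hG : G.IsBipartiteWith (X : Set V) Y) {v : V} (hv : v ∈ X) :
    ∑ w ∈ G.neighborFinset v, G.degree w ≤ G.edgeFinset.card := by
  rw [← isBipartiteWith_sum_degrees_eq_card_edges' hG]
  exact Finset.sum_le_sum_of_subset (isBipartiteWith_neighborFinset_subset hG hv)

end SimpleGraph

/-! ### The main theorem. -/

open SimpleGraph in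
theorem theorem3 {V : Type*} [Fintype V] [DecidableEq V]
    (G : SimpleGraph V) [DecidableRel G.Adj] (X Y : Finset V) (n : ℕ) (q₁ : ℝ)
    (hG : G.IsBalancedBipartiteWith X Y) (hconn : G.Connected)
    (hcard : Fintype.card V = 2 * n) (hn : 4 ≤ n) (hδ : 2 ≤ G.minDegree)
    (hq₁ : G.IsLargestSignlessLapEigenvalue q₁)
    (hq : 2 * ((n : ℝ) ^ 2 - n + 2) / n ≤ q₁) :
    G.IsBipancyclic := by
  have hB := hG.isBipartiteWith
  have hdisj : Disjoint X Y := Finset.disjoint_coe.1 hB.disjoint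
  have hXY : X.card + Y.card = 2 * n := by
    rw [← Finset.card_union_of_disjoint hdisj, hG.union_eq, Finset.card_univ, hcard]
  have hX : X.card = n := by have := hG.card_eq; omega
  have hY : Y.card = n := by omega
  have hdeg : ∀ v, 2 ≤ G.degree v := fun v => hδ.trans (G.minDegree_le_degree v)
  have hside : ∀ v, v ∈ X ∨ v ∈ Y := fun v => by
    rw [← Finset.mem_union, hG.union_eq]; exact Finset.mem_univ v
  have hdn : ∀ v, G.degree v ≤ n := fun v => by
    rcases hside v with hv | hv
    · exact hY ▸ isBipartiteWith_degree_le hB hv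
    · exact hX ▸ isBipartiteWith_degree_le' hB hv
  have hSe : ∀ v, ∑ w ∈ G.neighborFinset v, G.degree w ≤ G.edgeFinset.card := fun v => by
    rcases hside v with hv | hv
    · exact hB.sum_degree_neighborFinset_le hv
    · exact hB.symm.sum_degree_neighborFinset_le hv
  have hSn : ∀ v, ∑ w ∈ G.neighborFinset v, G.degree w ≤ G.degree v * n := fun v => by
    rw [← card_neighborFinset_eq_degree, ← smul_eq_mul]
    exact Finset.sum_le_card_nsmul _ _ _ fun w _ => hdn w
  have hn0 : (4 : ℝ) ≤ n := by exact_mod_cast hn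
  rw [div_le_iff₀ (by linarith)] at hq
  have hedges : n ^ 2 + 4 ≤ G.edgeFinset.card + 2 * n ∧
      (G.edgeFinset.card + 2 * n = n ^ 2 + 4 → ∀ v, 3 ≤ G.degree v) := by
    by_cases hlt : n ^ 2 + 4 < G.edgeFinset.card + 2 * n
    · exact ⟨hlt.le, fun h => absurd h hlt.ne'⟩
    rw [not_lt] at hlt
    have he : (G.edgeFinset.card : ℝ) + 2 * n ≤ n ^ 2 + 4 := by exact_mod_cast hlt
    generalize hE : G.edgeFinset.card = E at *
    have hrow : ∀ v, n * ((G.degree v : ℝ) ^ 2 +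
        ∑ w ∈ G.neighborFinset v, (G.degree w : ℝ)) ≤ G.degree v * (n ^ 2 + E) := by
      intro v
      have h1 : ∑ w ∈ G.neighborFinset v, (G.degree w : ℝ) ≤ E := by exact_mod_cast hSe v
      have h2 : ∑ w ∈ G.neighborFinset v, (G.degree w : ℝ) ≤ G.degree v * n := by
        exact_mod_cast hSn v
      have h3 : (G.degree v : ℝ) ≤ n := by exact_mod_cast hdn v
      have h4 : (0 : ℝ) ≤ G.degree v := by positivity
      generalize ∑ w ∈ G.neighborFinset v, (G.degree w : ℝ) = s at *
      generalize (G.degree v : ℝ) = d at *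
      -- For `nd ≤ E` use `s ≤ dn`; otherwise use `s ≤ E` and `(n - d)(nd - E) ≥ 0`.
      rcases le_total (n * d) (E : ℝ) with h5 | h5
      · nlinarith [mul_le_mul_of_nonneg_left h2 (by linarith : (0 : ℝ) ≤ n),
          mul_le_mul_of_nonneg_left h5 h4]
      · nlinarith [mul_le_mul_of_nonneg_left h1 (by linarith : (0 : ℝ) ≤ n),
          mul_nonneg (sub_nonneg.2 h3) (sub_nonneg.2 h5)]
    -- With so few edges no row sum exceeds `q₁`, so rigidity applies.
    have hEq : (n : ℝ) ^ 2 + E ≤ q₁ * n := by linarith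
    have hall := degree_sq_add_sum_eq_of_hasEigenvalue hconn
      (fun v => by have := hdeg v; omega) hq₁.1 <| by
        intro v
        have h4 : (0 : ℝ) ≤ G.degree v := by positivity
        have h1 := (hrow v).trans (mul_le_mul_of_nonneg_left hEq h4)
        refine le_of_mul_le_mul_left (h1.trans_eq ?_) (by linarith : (0 : ℝ) < n)
        ring
    have hqn : ∀ v, (G.degree v : ℝ) * (q₁ * n) ≤ G.degree v * (n ^ 2 + E) := by
      intro v
      have := hrow v
      rw [hall v] at this
      linarith
    obtain ⟨v₀⟩ := hconn.nonempty
    have hpos : (0 : ℝ) < G.degree v₀ := by have := hdeg v₀; exact_mod_cast (by omega)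
    have hEge := le_of_mul_le_mul_left (hqn v₀) hpos
    refine ⟨?_, fun _ v => ?_⟩
    · have : (n : ℝ) ^ 2 + 4 ≤ E + 2 * n := by linarith
      exact_mod_cast this
    · by_contra hv
      have hv2 : G.degree v = 2 := by have := hdeg v; omega
      have h1 := hall v
      have h2 : ∑ w ∈ G.neighborFinset v, (G.degree w : ℝ) ≤ G.degree v * n := by
        exact_mod_cast hSn v
      rw [hv2] at h1 h2
      push_cast at h1 h2
      have h3 : q₁ ≤ 2 + n := by linarith
      -- `q₁ ≤ n + 2` would give `(n - 2)² ≤ 0`.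
      nlinarith [mul_le_mul_of_nonneg_right h3 (by linarith : (0 : ℝ) ≤ n)]
  obtain ⟨hE, hE3⟩ := hedges
  obtain ⟨c, hc⟩ : ∃ c, G.IsCycleSeq (2 * n) c := by
    by_contra! hham
    rcases hE.eq_or_lt with heq | hlt
    · obtain ⟨k, m, hkm, hk, hm, hkme⟩ := card_edgeFinset_le_of_not_hamiltonian (by omega) hcard
        hX hY hB (hE3 heq.symm) hham
      obtain ⟨a, rfl⟩ := Nat.exists_eq_add_of_le hk
      obtain ⟨b, rfl⟩ := Nat.exists_eq_add_of_le hm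
      -- Here `km ≥ 3(n - 3) > 2n - 4`, since `n ≥ 6`.
      nlinarith [Nat.zero_le (a * b)]
    · obtain ⟨k, m, hkm, hk, hm, hkme⟩ := card_edgeFinset_le_of_not_hamiltonian (by omega) hcard
        hX hY hB hdeg hham
      obtain ⟨a, rfl⟩ := Nat.exists_eq_add_of_le hk
      obtain ⟨b, rfl⟩ := Nat.exists_eq_add_of_le hm
      nlinarith [Nat.zero_le (a * b)]
  refine hc.isBipancyclic hcard hB.mem_iff_notMem ?_
  -- `2(n² - 2n + 4) - n(n + 1) = n² - 5n + 8 > 0`.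
  nlinarith
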